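/- **Setting.** Let $M\ge 1$ and let $\mathcal S$ be an arbitrary non-empty set of states. For $s\in\mathcal S$ let $y^n=g_s^n(x^n)+\xi_s^n$ be the discrete channel with input, output and noise blocks in $(\mathbb Z/M)^n$, where $g_s^n(x^n)=(g_{s1}(x_1),g_{s2}(x^2),\dots,g_{sn}(x^n))$ is causal and one-to-one for every $n$, and the noise block $\Xi_s^n$ has an arbitrary law $p_s$ for each $s$ and $n$. The receiver knows $s$. Without feedback, the input $X^n$ is independent of the noise. With noiseless causal feedback, $x_k=f_k(w^n,y^{k-1})$ with message $W^n$ (any discrete random variable independent of the noise). With noisy causal feedback, $x_k=f_k(w^n,u^{k-1})$, $u_k=\beta_k(y^k)$, where the feedback functions $(\beta_k)_{k\le n}$ are random with an arbitrary discrete law (which may depend on $n$ and $s$), independent of message and channel noise, and their realization is unknown to transmitter and receiver. For an input $A^n$ ($A=X$ or $W$) put $i(a^n;y^n|s)=\log\frac{p_s(y^n|a^n)}{p_s(y^n)}$ and $$\underline I(\mathbf A;\mathbf Y|s)=\sup\{R:\lim_n\Pr\{\tfrac1n i(A^n;Y^n|s)\le R\}=0\},\qquad \underline{\underline I}(\mathbf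 A;\mathbf Y)=\sup\{R:\lim_n\sup_s\Pr\{\tfrac1n i(A^n;Y^n|s)\le R\}=0\}.$$ The information capacities are $$C_{NFB}=\sup_{\mathbf X}\underline{\underline I}(\mathbf X;\mathbf Y),\qquad C_{FB}=\sup_{\mathbf W,\mathbf F}\underline{\underline I}(\mathbf W;\mathbf Y),\qquad C_w=\inf_s\sup_{\mathbf W,\mathbf F}\underline I(\mathbf W;\mathbf Y|s),$$ where $\mathbf X$ ranges over all sequences of input laws and $(\mathbf W,\mathbf F)$ over all sequences of message laws and encoding functions with noiseless feedback; $C_{\mathrm{noisy}}$ is defined as $C_{FB}$ with the given noisy feedback in place of the noiseless one. With $\overline H(\boldsymbol\Xi|s)=\inf\{R:\lim_n\Pr\{-\frac1n\log p_s(\Xi_s^n)>R\}=0\}$, the compound noise is called uniform if $\lim_n\sup_{s}\Pr\{-\frac1n\log p_s(\Xi_s^n)>\sup_{s'}\overline H(\boldsymbol\Xi|s')+\delta\}=0$ for every $\delta>0$. **Theorem.** Suppose that the compound noise is uniform. Then: 1. Neither full transmitter CSI nor causal noiseless or noisy feedback increases the capacity: $C_{NFB}=C_{FB}=C_{\mathrm{noisy}}=C_w$.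 2. $\inf_s\sup_{\mathbf X}\underline I(\mathbf X;\mathbf Y|s)=\sup_{\mathbf X}\inf_s\underline I(\mathbf X;\mathbf Y|s)=C_w$, and likewise with feedback, $\inf_s\sup_{\mathbf W,\mathbf F}\underline I(\mathbf W;\mathbf Y|s)=\sup_{\mathbf W,\mathbf F}\inf_s\underline I(\mathbf W;\mathbf Y|s)$. 3. There is an $\mathbf X^*$ such that for every state $s^*$ attaining $\inf_s\sup_{\mathbf X}\underline I(\mathbf X;\mathbf Y|s)$ the pair $(\mathbf X^*,s^*)$ is a saddle point: $\underline I(\mathbf X;\mathbf Y|s^*)\le\underline I(\mathbf X^*;\mathbf Y^*|s^*)\le\underline I(\mathbf X^*;\mathbf Y^*|s)$ for all $\mathbf X$ and $s$. The same holds with feedback, with $(\mathbf W,\mathbf F)$ in place of $\mathbf X$. 4. Operationally, call $R$ achievable if there are block codes whose asymptotic rate is at least $R$ and whose error probability, averaged over equiprobable messages, tends to $0$ uniformly in $s$, where the decoder knows $s$ and the encoder does not; the operational capacity is the supremum of the achievable $R$. Then (a) $C_w$ is the infimum over $s$ of the operational capacity of the channel in state $s$ (codes may depend on $s$), both without and with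 noiseless feedback; (b) for random codes (drawn independently of $s$, message and noise, and known to transmitter and receiver; the error probability is averaged over the code) the operational compound capacities without feedback, with noiseless feedback and with noisy feedback all equal $C_w$; (c) for deterministic codes, the same three operational compound capacities all equal $C_w$, provided that for each $n$ the number $N_n$ of different pairs $(g_s^n,p_s(\xi^n))$, $s\in\mathcal S$, is finite and $\frac1n\log N_n\to0$ (for example if $\mathcal S$ is finite). -/

import Mathlib

open Filter Topology
open scoped ENNReal

noncomputable section

universe u

namespace CompoundChannel

/-! ### The additive-noise channel -/

/-- The compound channel `y^n = g_s^n(x^n) + ξ_s^n` over the `M`-ary alphabet `ZMod M` with state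
set `S`. `g s k` is the `k`-th response function (`k = 0, 1, …`), which sees the inputs up to and
including time `k`; `noise s n` is the law of the noise block of length `n` under state `s`,
completely arbitrary for every `s` and `n`. -/
structure AdditiveChannel (M : ℕ) (S : Type*) where
  g : S → (k : ℕ) → (Fin (k + 1) → ZMod M) → ZMod M
  noise : S → (n : ℕ) → PMF (Fin n → ZMod M)
  one_to_one : ∀ s n, Function.Injective
    (fun (x : Fin n → ZMod M) (k : Fin n) =>
      g s k (fun j : Fin (k + 1) => x ⟨j, by omega⟩))

/-- A transmission strategy of blocklength `n` with feedback alphabet `U`: the symbol sent at time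
`k` is a function of the `k` feedback symbols received before. -/
abbrev Strategy (M : ℕ) (U : Type u) (n : ℕ) : Type u :=
  (k : Fin n) → (Fin k → U) → ZMod M

/-- Feedback functions `u_k = β_k(y^k)` of blocklength `n`. -/
abbrev FeedbackMap (M : ℕ) (U : Type u) (n : ℕ) : Type u :=
  (k : Fin n) → (Fin (k + 1) → ZMod M) → U

/-- A message law and encoding functions `x_k = f_k(w, u^{k-1})` for every blocklength. The message
of a block is any discrete random variable, labelled by natural numbers. -/
structure MessageScheme (M : ℕ) (U : Type u) where
  law : ℕ → PMF ℕ
  enc : (n : ℕ) → ℕ → Strategy M U n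

/-- A family of effective channels, indexed by the state and the blocklength, with `M`-ary output
block and abstract input set `α n`. -/
abbrev CompoundKernel (S : Type*) (α : ℕ → Type*) (M : ℕ) : Type _ :=
  S → (n : ℕ) → α n → PMF (Fin n → ZMod M)

/-- The output at time `k` when the input at time `j` is `f j (y^{j-1})` and the noise
block is `ξ`: `y_k = g_k(x^k) + ξ_k` with `x_j = f_j(y^{j-1})`. -/
def outputAt {M n : ℕ} (g : (k : ℕ) → (Fin (k + 1) → ZMod M) → ZMod M)
    (f : Strategy M (ZMod M) n) (ξ : Fin n → ZMod M) (k : ℕ) (hk : k < n) : ZMod M :=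
  g k (fun j : Fin (k + 1) =>
    f ⟨j, by omega⟩ (fun i : Fin j => outputAt g f ξ i (by omega))) + ξ ⟨k, hk⟩
termination_by k
decreasing_by exact lt_of_lt_of_le i.isLt (Nat.lt_succ_iff.mp j.isLt)

/-- The output block of the closed feedback loop. -/
def output {M n : ℕ} (g : (k : ℕ) → (Fin (k + 1) → ZMod M) → ZMod M)
    (f : Strategy M (ZMod M) n) (ξ : Fin n → ZMod M) : Fin n → ZMod M :=
  fun k => outputAt g f ξ k k.isLt

/-- The strategy in terms of past outputs that results from the strategy `f` and the
feedback functions `β`: `x_k = f_k(u^{k-1})`, `u_i = β_i(y^i)`. -/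
def viaFeedback {M n : ℕ} {U : Type*} (f : Strategy M U n) (β : FeedbackMap M U n) :
    Strategy M (ZMod M) n :=
  fun k y => f k (fun i : Fin k =>
    β ⟨i, by omega⟩ (fun j : Fin (i + 1) => y ⟨j, by omega⟩))

namespace AdditiveChannel

variable {M : ℕ} {S : Type*} (ch : AdditiveChannel M S)

/-- The noiseless channel response `z^n = g_s^n(x^n)`. -/
def response (s : S) (n : ℕ) (x : Fin n → ZMod M) : Fin n → ZMod M :=
  fun k => ch.g s k (fun j : Fin (k + 1) => x ⟨j, by omega⟩)

/-- The channel without feedback: input block to output block. -/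
def kernel : CompoundKernel S (fun n => Fin n → ZMod M) M :=
  fun s n x => (ch.noise s n).map (fun ξ => ch.response s n x + ξ)

/-- The effective channel with noiseless causal feedback: strategy to output block. -/
def feedbackKernel : CompoundKernel S (Strategy M (ZMod M)) M :=
  fun s n f => (ch.noise s n).map (output (ch.g s) f)

/-- The effective channel with noisy causal feedback: strategy to output block. The feedback
functions of blocklength `n` are drawn from the law `Φ s n`, independently of the channel noise;
their realization is seen by neither the transmitter nor the receiver. -/
def noisyFeedbackKernel {U : Type*} (Φ : S → (n : ℕ) → PMF (FeedbackMap M U n)) :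
    CompoundKernel S (Strategy M U) M :=
  fun s n f => (Φ s n).bind fun β => (ch.noise s n).map (output (ch.g s) (viaFeedback f β))

end AdditiveChannel

/-! ### Information-spectrum quantities -/

/-- The probability that `n⁻¹ i(X^n; Y^n) ≤ R` when the input has law `P` and the channel is `κ`,
where `i(x; y) = log (p(y|x) / p(y))`. -/
def infoLowerTail {α β : Type*} (n : ℕ) (P : PMF α) (κ : α → PMF β) (R : ℝ) : ℝ≥0∞ :=
  (P.bind fun a => (κ a).map (Prod.mk a)).toOuterMeasure
    {ab | (n : ℝ)⁻¹ * Real.log ((κ ab.1 ab.2).toReal / ((P.bind κ) ab.2).toReal) ≤ R}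

/-- The inf-information rate of a single channel. -/
def infRate {α β : ℕ → Type*} (P : ∀ n, PMF (α n)) (κ : ∀ n, α n → PMF (β n)) : EReal :=
  ⨆ (R : ℝ) (_ : Tendsto (fun n => infoLowerTail n (P n) (κ n) R) atTop (𝓝 0)), (R : EReal)

/-- The compound inf-information rate. -/
def compoundInfRate {S : Type*} {α β : ℕ → Type*} (P : ∀ n, PMF (α n))
    (κ : S → ∀ n, α n → PMF (β n)) : EReal :=
  ⨆ (R : ℝ) (_ : Tendsto (fun n => ⨆ s, infoLowerTail n (P n) (κ s n) R) atTop (𝓝 0)), (R : EReal)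

namespace AdditiveChannel

variable {M : ℕ} {S : Type*} (ch : AdditiveChannel M S)

/-- The noise entropy density rate `n⁻¹ h(ξ^n|s)`, with `h(ξ^n|s) = -log p_s(ξ^n)`. -/
def entropyDensity (s : S) (n : ℕ) (ξ : Fin n → ZMod M) : ℝ :=
  (n : ℝ)⁻¹ * (-Real.log (ch.noise s n ξ).toReal)

/-- The sup-entropy rate of the noise under state `s`. -/
def supEntropyRate (s : S) : EReal :=
  ⨅ (R : ℝ) (_ : Tendsto (fun n => (ch.noise s n).toOuterMeasure {ξ | R < ch.entropyDensity s n ξ})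
    atTop (𝓝 0)), (R : EReal)

/-- The compound noise is uniform: for every `δ > 0`,
`Pr {n⁻¹ h(Ξ_s^n|s) > sup_s H̄(Ξ|s) + δ} → 0` uniformly in the state. -/
def UniformNoise : Prop :=
  ∀ δ : ℝ, 0 < δ → Tendsto (fun n => ⨆ s, (ch.noise s n).toOuterMeasure
    {ξ | (⨆ s', ch.supEntropyRate s') + (δ : EReal) < (ch.entropyDensity s n ξ : EReal)})
    atTop (𝓝 0)

/-- `I(X;Y|s)`: the inf-information rate under state `s`, no feedback. -/
def rate (X : ∀ n, PMF (Fin n → ZMod M)) (s : S) : EReal :=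
  infRate X (ch.kernel s)

/-- `I(W;Y|s)`: the inf-information rate under state `s` of the effective channel from
the message to the output, with noiseless feedback and encoding functions `F`. -/
def feedbackRate (WF : MessageScheme M (ZMod M)) (s : S) : EReal :=
  infRate WF.law (fun n w => ch.feedbackKernel s n (WF.enc n w))

/-- Compound capacity without feedback, `sup_X` of the compound inf-information rate. -/
def C_NFB : EReal :=
  ⨆ X : ∀ n, PMF (Fin n → ZMod M), compoundInfRate X ch.kernel

/-- Compound capacity with noiseless causal feedback, `sup_{W,F}` of the compound inf-information
rate. -/
def C_FB : EReal :=
  ⨆ WF : MessageScheme M (ZMod M),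
    compoundInfRate WF.law (fun s n w => ch.feedbackKernel s n (WF.enc n w))

/-- Compound capacity with noisy causal feedback. -/
def C_noisyFB {U : Type*} (Φ : S → (n : ℕ) → PMF (FeedbackMap M U n)) : EReal :=
  ⨆ WF : MessageScheme M U,
    compoundInfRate WF.law (fun s n w => ch.noisyFeedbackKernel Φ s n (WF.enc n w))

/-- Worst-case capacity: the state is known to the transmitter (and feedback is available). -/
def C_w : EReal :=
  ⨅ s, ⨆ WF : MessageScheme M (ZMod M), ch.feedbackRate WF s

/-- The number of different channels of blocklength `n` (pairs of response and noise law) is finite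
and grows subexponentially in `n`. This holds in particular if `S` is finite. -/
def SubexponentialStates : Prop :=
  (∀ n, (Set.range fun s => (ch.response s n, ch.noise s n)).Finite) ∧
  Tendsto (fun n : ℕ =>
    Real.log ((Set.range fun s => (ch.response s n, ch.noise s n)).ncard : ℝ) / (n : ℝ))
    atTop (𝓝 0)

end AdditiveChannel

/-! ### Codes and operational capacity -/

/-- A block code with `K` messages. The encoder does not see the state, the decoder does. -/
structure BlockCode (S : Type*) (α : Type*) (M n K : ℕ) where
  enc : Fin K → α
  dec : S → (Fin n → ZMod M) → Fin K

/-- Error probability of the code under state `s`, averaged over equiprobable messages. -/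
def BlockCode.error {S : Type*} {α : ℕ → Type*} {M n K : ℕ} (c : BlockCode S (α n) M n K)
    (κ : CompoundKernel S α M) (s : S) : ℝ≥0∞ :=
  (∑ w : Fin K, (κ s n (c.enc w)).toOuterMeasure {y | c.dec s y ≠ w}) / (K : ℝ≥0∞)

/-- `R` is an achievable rate: some codes have asymptotic rate at least `R` and
error probabilities that tend to zero uniformly in the state. -/
def Achievable {S : Type*} {α : ℕ → Type*} {M : ℕ} (κ : CompoundKernel S α M) (R : ℝ) : Prop :=
  ∃ (K : ℕ → ℕ) (c : ∀ n, BlockCode S (α n) M n (K n)),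
    (∀ δ : ℝ, 0 < δ → ∀ᶠ n : ℕ in atTop, R - δ < Real.log (K n) / n) ∧
    Tendsto (fun n => ⨆ s, (c n).error κ s) atTop (𝓝 0)

/-- Achievability by random codes: the code of each blocklength is drawn, independently of the
state, message and noise, from a law `Q n`, and is known to transmitter and receiver. -/
def RandomAchievable {S : Type*} {α : ℕ → Type*} {M : ℕ} (κ : CompoundKernel S α M) (R : ℝ) :
    Prop :=
  ∃ (K : ℕ → ℕ) (Q : ∀ n, PMF (BlockCode S (α n) M n (K n))),
    (∀ δ : ℝ, 0 < δ → ∀ᶠ n : ℕ in atTop, R - δ < Real.log (K n) / n) ∧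
    Tendsto (fun n => ⨆ s, ∑' c, Q n c * c.error κ s) atTop (𝓝 0)

/-- Operational capacity: the supremum of the rates achievable with deterministic codes. -/
def opCapacity {S : Type*} {α : ℕ → Type*} {M : ℕ} (κ : CompoundKernel S α M) : EReal :=
  ⨆ (R : ℝ) (_ : Achievable κ R), (R : EReal)

/-- Operational capacity for random codes. -/
def randomOpCapacity {S : Type*} {α : ℕ → Type*} {M : ℕ} (κ : CompoundKernel S α M) : EReal :=
  ⨆ (R : ℝ) (_ : RandomAchievable κ R), (R : EReal)

/-- The channel family reduced to the single state `s`, so that the code may depend on `s`. -/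
def atState {S : Type*} {α : ℕ → Type*} {M : ℕ} (κ : CompoundKernel S α M) (s : S) :
    CompoundKernel Unit α M :=
  fun _ => κ s

end CompoundChannel

end

/-! In every state all the rates equal log M minus the sup-entropy rate of the noise.

Converse: for a fixed strategy and fixed feedback functions the output block is an injective
function of the noise block, so its law is a permutation of the noise law; noisy feedback only mixes
such permutations. `IsScrambling` is the trace of this that survives mixing: the mass of small noise
atoms is at most μ(A) + θ|Aᶜ|. With A the outputs of low information density, or the decoding
errors, |Aᶜ| is on average at most M^n e^{-nR}, or M^n/K. Hence
`IsScrambling.smallAtoms_le_infoLowerTail` and `BlockCode.smallAtoms_le_error`.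

Attainment: the response is a bijection of blocks, so the equiprobable input makes the output
equiprobable and the information density rate equals log M minus the entropy density rate
(`infoLowerTail_uniformInput_le`). This input is optimal in all states at once, whence minimax and
saddle points; uniform noise makes the tails vanish uniformly in the state. For codes, the error of
threshold decoding is at most an entropy tail plus a confusion term
(`thresholdCode_error_le_entropy`). The tail does not involve the codebook, so one codebook need
only control the confusion of N_n channels, at the price of a factor N_n. -/

namespace CompoundChannel

/-! ### Scramblings of a noise law -/

section Scrambling

variable {Y : Type*} [Fintype Y]

/-- Every set `A` that is likely under `μ`, up to a few missing points, contains the part of `ν`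
carried by atoms of small mass. Mixtures of injective images of `ν` have this property. -/
def IsScrambling (ν μ : PMF Y) : Prop :=
  ∀ (θ : ℝ≥0∞) (A : Set Y),
    ν.toOuterMeasure {ξ | ν ξ ≤ θ} ≤ μ.toOuterMeasure A + θ * ∑ y, Aᶜ.indicator 1 y

/-- Atom by atom: either e ξ lies in A and ν ξ is counted there, or e ξ is one of the missing points
and a small atom weighs at most θ. -/
theorem isScrambling_map (ν : PMF Y) {e : Y → Y} (he : Function.Injective e) :
    IsScrambling ν (ν.map e) := by
  classical
  intro θ A
  have hbij : Function.Bijective e := Finite.injective_iff_bijective.mp he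
  have hsum : ∑ y, Aᶜ.indicator (1 : Y → ℝ≥0∞) y = ∑ ξ, Aᶜ.indicator (1 : Y → ℝ≥0∞) (e ξ) :=
    (Function.Bijective.sum_comp hbij _).symm
  rw [PMF.toOuterMeasure_map_apply, PMF.toOuterMeasure_apply_fintype,
    PMF.toOuterMeasure_apply_fintype, hsum, Finset.mul_sum, ← Finset.sum_add_distrib]
  refine Finset.sum_le_sum fun ξ _ => ?_
  by_cases hA : e ξ ∈ A
  · have : ξ ∈ e ⁻¹' A := hA
    rw [Set.indicator_of_mem this]
    exact (Set.indicator_le_self' (fun _ _ => zero_le) ξ).trans le_self_add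
  · have : e ξ ∈ Aᶜ := hA
    rw [Set.indicator_of_mem this, Pi.one_apply, mul_one]
    refine le_trans ?_ le_add_self
    by_cases h : ξ ∈ {ξ | ν ξ ≤ θ}
    · rw [Set.indicator_of_mem h]; exact h
    · rw [Set.indicator_of_notMem h]; exact zero_le

theorem le_tsum_mul_of_forall_le {B : Type*} (φ : PMF B) {c : ℝ≥0∞} {f : B → ℝ≥0∞}
    (h : ∀ b, c ≤ f b) : c ≤ ∑' b, φ b * f b := by
  calc c = ∑' b, φ b * c := by rw [ENNReal.tsum_mul_right, φ.tsum_coe, one_mul]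
    _ ≤ _ := ENNReal.tsum_le_tsum fun b => mul_le_mul_right (h b) _

theorem tsum_mul_le_of_forall_le {B : Type*} (φ : PMF B) {c : ℝ≥0∞} {f : B → ℝ≥0∞}
    (h : ∀ b, f b ≤ c) : ∑' b, φ b * f b ≤ c := by
  calc ∑' b, φ b * f b ≤ ∑' b, φ b * c := ENNReal.tsum_le_tsum fun b => mul_le_mul_right (h b) _
    _ = c := by rw [ENNReal.tsum_mul_right, φ.tsum_coe, one_mul]

/-- The inequality is affine in μ, so it passes to averages. Noisy feedback needs this: its output
law is no longer a permutation of the noise law. -/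
theorem isScrambling_bind {B : Type*} {ν : PMF Y} (φ : PMF B) {f : B → PMF Y}
    (h : ∀ b, IsScrambling ν (f b)) : IsScrambling ν (φ.bind f) := by
  intro θ A
  rw [PMF.toOuterMeasure_bind_apply]
  calc _ ≤ ∑' b, φ b * ((f b).toOuterMeasure A + θ * ∑ y, Aᶜ.indicator 1 y) :=
        le_tsum_mul_of_forall_le φ fun b => h b θ A
    _ = _ := by
      simp_rw [mul_add]
      rw [ENNReal.tsum_add, ENNReal.tsum_mul_right, φ.tsum_coe, one_mul]

theorem infoLowerTail_eq_tsum {α β : Type*} (n : ℕ) (P : PMF α) (κ : α → PMF β) (R : ℝ) :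
    infoLowerTail n P κ R = ∑' a, P a * (κ a).toOuterMeasure
      {b | (n : ℝ)⁻¹ * Real.log ((κ a b).toReal / ((P.bind κ) b).toReal) ≤ R} := by
  rw [infoLowerTail, PMF.toOuterMeasure_bind_apply]
  simp_rw [PMF.toOuterMeasure_map_apply]
  rfl

/-- Information converse: for a channel that scrambles `ν`, the noise atoms of mass at most `θ` are
either counted in the lower tail of the information density or few. -/
theorem IsScrambling.smallAtoms_le_infoLowerTail {α : Type*} {ν : PMF Y} {κ : α → PMF Y}
    (h : ∀ a, IsScrambling ν (κ a)) (P : PMF α) {n : ℕ} (hn : n ≠ 0) (R : ℝ) (θ : ℝ≥0∞) :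
    ν.toOuterMeasure {ξ | ν ξ ≤ θ} ≤ infoLowerTail n P κ R +
      θ * (ENNReal.ofReal (Real.exp (-(n * R))) * Fintype.card Y) := by
  classical
  set q := P.bind κ with hq
  -- The pairs with κ a y = 0 or P a = 0 have no mass; putting them into A keeps the quotient and
  -- the logarithm genuine on Aᶜ.
  set A : α → Set Y := fun a => {y | κ a y = 0 ∨ P a = 0 ∨
    (n : ℝ)⁻¹ * Real.log ((κ a y).toReal / (q y).toReal) ≤ R} with hA
  -- Change of measure: off A the ratio κ/q exceeds e^{nR}. Summed over a, the right side becomes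
  -- e^{-nR} q/q, so each y counts at most e^{-nR}.
  have key : ∀ a y, P a * (A a)ᶜ.indicator (1 : Y → ℝ≥0∞) y ≤
      ENNReal.ofReal (Real.exp (-(n * R))) * (P a * κ a y * (q y)⁻¹) := by
    intro a y
    by_cases hy : y ∈ (A a)ᶜ
    · rw [Set.indicator_of_mem hy, Pi.one_apply, mul_one]
      simp only [hA, Set.mem_compl_iff, Set.mem_ofPred_eq, not_or, not_le] at hy
      obtain ⟨hk, hP, hR⟩ := hy
      have hqy : q y ≠ 0 := by
        rw [hq, ← PMF.mem_support_iff, PMF.mem_support_bind_iff]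
        exact ⟨a, (PMF.mem_support_iff _ _).2 hP, (PMF.mem_support_iff _ _).2 hk⟩
      have hkt := (κ a).apply_ne_top y
      have hqt := q.apply_ne_top y
      have hkpos := ENNReal.toReal_pos hk hkt
      have hqpos := ENNReal.toReal_pos hqy hqt
      have hnpos : (0 : ℝ) < n := by positivity
      have h1 : n * R ≤ Real.log ((κ a y).toReal / (q y).toReal) := by
        rw [inv_mul_eq_div, lt_div_iff₀ hnpos] at hR
        linarith
      rw [Real.le_log_iff_exp_le (by positivity)] at h1
      have h2 : 1 ≤ Real.exp (-(n * R)) * ((κ a y).toReal / (q y).toReal) := by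
        calc (1 : ℝ) = Real.exp (-(n * R)) * Real.exp (n * R) := by
              rw [← Real.exp_add]; simp
          _ ≤ _ := by gcongr
      have h3 : (1 : ℝ≥0∞) ≤ ENNReal.ofReal (Real.exp (-(n * R))) * (κ a y * (q y)⁻¹) := by
        have : κ a y * (q y)⁻¹ = ENNReal.ofReal ((κ a y).toReal / (q y).toReal) := by
          rw [ENNReal.ofReal_div_of_pos hqpos, ENNReal.ofReal_toReal hkt,
            ENNReal.ofReal_toReal hqt, div_eq_mul_inv]
        rw [this, ← ENNReal.ofReal_mul (Real.exp_nonneg _)]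
        exact ENNReal.one_le_ofReal.2 h2
      calc P a = P a * 1 := (mul_one _).symm
        _ ≤ P a * (ENNReal.ofReal (Real.exp (-(n * R))) * (κ a y * (q y)⁻¹)) :=
            mul_le_mul_right h3 _
        _ = _ := by ring
    · rw [Set.indicator_of_notMem hy, mul_zero]; exact zero_le
  have tail : ∑' a, P a * (κ a).toOuterMeasure (A a) ≤ infoLowerTail n P κ R := by
    rw [infoLowerTail_eq_tsum]
    refine ENNReal.tsum_le_tsum fun a => ?_
    by_cases hP : P a = 0
    · simp [hP]
    refine mul_le_mul_right (PMF.toOuterMeasure_mono _ ?_) _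
    rintro y ⟨hy, hsupp⟩
    rcases hy with h0 | h0 | h0
    · exact absurd h0 ((PMF.mem_support_iff _ _).1 hsupp)
    · exact absurd h0 hP
    · exact h0
  have count : ∑' a, P a * ∑ y, (A a)ᶜ.indicator (1 : Y → ℝ≥0∞) y ≤
      ENNReal.ofReal (Real.exp (-(n * R))) * Fintype.card Y := by
    calc ∑' a, P a * ∑ y, (A a)ᶜ.indicator (1 : Y → ℝ≥0∞) y
        = ∑ y, ∑' a, P a * (A a)ᶜ.indicator (1 : Y → ℝ≥0∞) y := by
          simp_rw [Finset.mul_sum]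
          exact Summable.tsum_finsetSum fun _ _ => ENNReal.summable
      _ ≤ ∑ y : Y, ENNReal.ofReal (Real.exp (-(n * R))) := by
          refine Finset.sum_le_sum fun y _ => ?_
          refine (ENNReal.tsum_le_tsum fun a => key a y).trans ?_
          rw [ENNReal.tsum_mul_left, ENNReal.tsum_mul_right, ← PMF.bind_apply]
          exact mul_le_of_le_one_right zero_le (ENNReal.mul_inv_le_one _)
      _ = _ := by rw [Finset.sum_const, Finset.card_univ, nsmul_eq_mul, mul_comm]
  calc ν.toOuterMeasure {ξ | ν ξ ≤ θ}
      ≤ ∑' a, P a * ((κ a).toOuterMeasure (A a) + θ * ∑ y, (A a)ᶜ.indicator 1 y) :=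
        le_tsum_mul_of_forall_le P fun a => h a θ (A a)
    _ = ∑' a, P a * (κ a).toOuterMeasure (A a) +
        θ * ∑' a, P a * ∑ y, (A a)ᶜ.indicator (1 : Y → ℝ≥0∞) y := by
      rw [← ENNReal.tsum_mul_left, ← ENNReal.tsum_add]
      refine tsum_congr fun a => ?_
      ring
    _ ≤ _ := by gcongr

end Scrambling

/-- Coding converse: for a channel that scrambles `ν`, the noise atoms of mass at most `θ` are
either counted in the error probability of a code or few compared to the number of messages. -/
theorem BlockCode.smallAtoms_le_error {S : Type*} {α : ℕ → Type*} {M n K : ℕ} [NeZero M]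
    (c : BlockCode S (α n) M n K) (κ : CompoundKernel S α M) (s : S)
    {ν : PMF (Fin n → ZMod M)} (h : ∀ a, IsScrambling ν (κ s n a)) (θ : ℝ≥0∞) :
    ν.toOuterMeasure {ξ | ν ξ ≤ θ} ≤ c.error κ s + θ * ((M : ℝ≥0∞) ^ n / K) := by
  classical
  have hK : K ≠ 0 := by
    rintro rfl
    exact (c.dec s 0).elim0
  have hK' : (K : ℝ≥0∞) ≠ 0 := by exact_mod_cast hK
  have hKt : (K : ℝ≥0∞) ≠ ∞ := ENNReal.natCast_ne_top K
  -- The decoding regions partition the M^n output blocks.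
  have count : ∑ w : Fin K, ∑ y, {y | c.dec s y ≠ w}ᶜ.indicator (1 : (Fin n → ZMod M) → ℝ≥0∞) y =
      (M : ℝ≥0∞) ^ n := by
    rw [Finset.sum_comm]
    have : ∀ y, ∑ w : Fin K,
        {y | c.dec s y ≠ w}ᶜ.indicator (1 : (Fin n → ZMod M) → ℝ≥0∞) y = 1 := by
      intro y
      simp [Set.indicator_apply]
    simp [this, Finset.card_univ, ZMod.card]
  have hsum : (K : ℝ≥0∞) * ν.toOuterMeasure {ξ | ν ξ ≤ θ} ≤
      ∑ w : Fin K, (κ s n (c.enc w)).toOuterMeasure {y | c.dec s y ≠ w} +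
        θ * (M : ℝ≥0∞) ^ n := by
    rw [← count, Finset.mul_sum, ← Finset.sum_add_distrib]
    calc (K : ℝ≥0∞) * ν.toOuterMeasure {ξ | ν ξ ≤ θ}
        = ∑ _w : Fin K, ν.toOuterMeasure {ξ | ν ξ ≤ θ} := by simp
      _ ≤ _ := Finset.sum_le_sum fun w _ => h (c.enc w) θ {y | c.dec s y ≠ w}
  rw [BlockCode.error, ← mul_div_assoc, ← ENNReal.add_div, ENNReal.le_div_iff_mul_le
    (Or.inl hK') (Or.inl hKt), mul_comm]
  exact hsum

/-! ### The kernels of the additive channel scramble the noise -/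

theorem output_apply {M n : ℕ} (g : (k : ℕ) → (Fin (k + 1) → ZMod M) → ZMod M)
    (f : Strategy M (ZMod M) n) (ξ : Fin n → ZMod M) (k : Fin n) :
    output g f ξ k = g k (fun j : Fin (k + 1) => f ⟨j, by omega⟩
      (fun i : Fin j => output g f ξ ⟨i, by omega⟩)) + ξ k := by
  rw [output, outputAt]
  rfl

/-- The output block determines the feedback, hence the inputs and the noiseless response; the noise
is what remains after subtraction. -/
theorem output_injective {M n : ℕ} (g : (k : ℕ) → (Fin (k + 1) → ZMod M) → ZMod M)
    (f : Strategy M (ZMod M) n) : Function.Injective (output g f) := by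
  intro ξ ξ' h
  funext k
  have hk := congrFun h k
  rw [output_apply g f ξ, output_apply g f ξ', h] at hk
  exact add_left_cancel hk

/-- The strategy that sends a fixed block and ignores the feedback. -/
def constStrategy {M n : ℕ} (U : Type*) (x : Fin n → ZMod M) : Strategy M U n :=
  fun k _ => x k

namespace AdditiveChannel

variable {M : ℕ} {S : Type*} (ch : AdditiveChannel M S)

theorem response_injective (s : S) (n : ℕ) : Function.Injective (ch.response s n) :=
  ch.one_to_one s n

theorem output_constStrategy (s : S) {n : ℕ} (x ξ : Fin n → ZMod M) :
    output (ch.g s) (constStrategy (ZMod M) x) ξ = ch.response s n x + ξ := by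
  funext k
  rw [output_apply]
  rfl

theorem feedbackKernel_constStrategy (s : S) {n : ℕ} (x : Fin n → ZMod M) :
    ch.feedbackKernel s n (constStrategy (ZMod M) x) = ch.kernel s n x := by
  rw [feedbackKernel, kernel]
  congr 1
  funext ξ
  exact ch.output_constStrategy s x ξ

theorem noisyFeedbackKernel_constStrategy {U : Type*}
    (Φ : S → (n : ℕ) → PMF (FeedbackMap M U n)) (s : S) {n : ℕ} (x : Fin n → ZMod M) :
    ch.noisyFeedbackKernel Φ s n (constStrategy U x) = ch.kernel s n x := by
  rw [← feedbackKernel_constStrategy]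
  exact PMF.bind_const (Φ s n) (ch.feedbackKernel s n (constStrategy (ZMod M) x))

theorem kernel_apply (s : S) (n : ℕ) (x y : Fin n → ZMod M) :
    ch.kernel s n x y = ch.noise s n (y - ch.response s n x) := by
  classical
  rw [kernel, PMF.map_apply, tsum_eq_single (y - ch.response s n x)]
  · simp
  · intro ξ hξ
    refine if_neg fun h => hξ ?_
    rw [h]; abel

theorem isScrambling_feedbackKernel [NeZero M] (s : S) (n : ℕ) (f : Strategy M (ZMod M) n) :
    IsScrambling (ch.noise s n) (ch.feedbackKernel s n f) :=
  isScrambling_map _ (output_injective _ f)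

theorem isScrambling_kernel [NeZero M] (s : S) (n : ℕ) (x : Fin n → ZMod M) :
    IsScrambling (ch.noise s n) (ch.kernel s n x) :=
  isScrambling_map _ (add_right_injective _)

theorem isScrambling_noisyFeedbackKernel [NeZero M] {U : Type*}
    (Φ : S → (n : ℕ) → PMF (FeedbackMap M U n)) (s : S) (n : ℕ) (f : Strategy M U n) :
    IsScrambling (ch.noise s n) (ch.noisyFeedbackKernel Φ s n f) :=
  isScrambling_bind _ fun _ => isScrambling_map _ (output_injective _ _)

/-! ### Entropy rates -/

theorem entropyDensity_subset_smallAtoms (s : S) {n : ℕ} (hn : n ≠ 0) (t : ℝ) :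
    {ξ | t < ch.entropyDensity s n ξ} ⊆
      {ξ | ch.noise s n ξ ≤ ENNReal.ofReal (Real.exp (-(n * t)))} := by
  intro ξ hξ
  have hn' : (0 : ℝ) < n := by positivity
  by_cases h0 : ch.noise s n ξ = 0
  · simp [h0]
  have hpos := ENNReal.toReal_pos h0 ((ch.noise s n).apply_ne_top ξ)
  simp only [Set.mem_ofPred_eq, entropyDensity, inv_mul_eq_div, lt_div_iff₀ hn'] at hξ ⊢
  rw [ENNReal.le_ofReal_iff_toReal_le ((ch.noise s n).apply_ne_top ξ) (Real.exp_nonneg _),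
    ← Real.log_le_iff_le_exp hpos]
  linarith

/-- Null atoms are excluded because log 0 = 0 gives them density 0. -/
theorem lt_entropyDensity_of_lt (s : S) {n : ℕ} (hn : n ≠ 0) {t : ℝ} {ξ : Fin n → ZMod M}
    (h0 : ch.noise s n ξ ≠ 0) (h : ch.noise s n ξ < ENNReal.ofReal (Real.exp (-(n * t)))) :
    t < ch.entropyDensity s n ξ := by
  have hn' : (0 : ℝ) < n := by positivity
  have hpos := ENNReal.toReal_pos h0 ((ch.noise s n).apply_ne_top ξ)
  rw [ENNReal.lt_ofReal_iff_toReal_lt ((ch.noise s n).apply_ne_top ξ),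
    ← Real.log_lt_iff_lt_exp hpos] at h
  rw [entropyDensity, inv_mul_eq_div, lt_div_iff₀ hn']
  linarith

theorem supEntropyRate_le {s : S} {t : ℝ}
    (h : Tendsto (fun n => (ch.noise s n).toOuterMeasure {ξ | t < ch.entropyDensity s n ξ})
      atTop (𝓝 0)) : ch.supEntropyRate s ≤ t :=
  iInf₂_le t h

theorem tendsto_of_supEntropyRate_lt {s : S} {t : ℝ} (h : ch.supEntropyRate s < t) :
    Tendsto (fun n => (ch.noise s n).toOuterMeasure {ξ | t < ch.entropyDensity s n ξ})
      atTop (𝓝 0) := by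
  simp only [supEntropyRate, iInf_lt_iff] at h
  obtain ⟨R, hR, hlt⟩ := h
  rw [EReal.coe_lt_coe_iff] at hlt
  refine tendsto_of_tendsto_of_tendsto_of_le_of_le tendsto_const_nhds hR (fun _ => zero_le)
    fun n => PMF.toOuterMeasure_mono _ ?_
  exact fun ξ hξ => hlt.trans hξ.1

theorem tendsto_ofReal_exp_neg_mul {ε : ℝ} (hε : 0 < ε) :
    Tendsto (fun n : ℕ => ENNReal.ofReal (Real.exp (-(n * ε)))) atTop (𝓝 0) := by
  rw [← ENNReal.ofReal_zero]
  refine ENNReal.tendsto_ofReal (Real.tendsto_exp_neg_atTop_nhds_zero.comp ?_)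
  exact tendsto_natCast_atTop_atTop.atTop_mul_const hε

theorem natCast_pow_eq_ofReal_exp [NeZero M] (n : ℕ) :
    (M : ℝ≥0∞) ^ n = ENNReal.ofReal (Real.exp (n * Real.log M)) := by
  have hM : (0 : ℝ) < M := by exact_mod_cast Nat.pos_of_neZero M
  rw [Real.exp_nat_mul, Real.exp_log hM, ENNReal.ofReal_pow hM.le, ENNReal.ofReal_natCast]

theorem card_block [NeZero M] (n : ℕ) :
    (Fintype.card (Fin n → ZMod M) : ℝ≥0∞) = (M : ℝ≥0∞) ^ n := by
  simp [ZMod.card]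

theorem supEntropyRate_nonneg (s : S) : 0 ≤ ch.supEntropyRate s := by
  refine le_iInf₂ fun R hR => ?_
  by_contra! hlt
  have hR0 : R < 0 := by exact_mod_cast hlt
  have h1 : ∀ n, (ch.noise s n).toOuterMeasure {ξ | R < ch.entropyDensity s n ξ} = 1 := by
    intro n
    rw [PMF.toOuterMeasure_apply_eq_one_iff]
    intro ξ _
    refine hR0.trans_le (mul_nonneg (by positivity) (neg_nonneg.2 (Real.log_nonpos ?_ ?_)))
    · exact ENNReal.toReal_nonneg
    · exact ENNReal.toReal_le_of_le_ofReal zero_le_one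
        (by simpa using (ch.noise s n).coe_le_one ξ)
  simp only [h1] at hR
  exact one_ne_zero (tendsto_nhds_unique tendsto_const_nhds hR)

theorem supEntropyRate_le_log [NeZero M] (s : S) : ch.supEntropyRate s ≤ Real.log M := by
  refine EReal.le_of_forall_lt_iff_le.1 fun t ht => ch.supEntropyRate_le ?_
  rw [EReal.coe_lt_coe_iff] at ht
  refine tendsto_of_tendsto_of_tendsto_of_le_of_le' tendsto_const_nhds
    (tendsto_ofReal_exp_neg_mul (sub_pos.2 ht)) (Eventually.of_forall fun _ => zero_le) ?_
  filter_upwards [eventually_ne_atTop 0] with n hn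
  refine (PMF.toOuterMeasure_mono _ (Set.inter_subset_left.trans
    (ch.entropyDensity_subset_smallAtoms s hn t))).trans ?_
  -- With A empty the scrambling bound is plain counting: M^n atoms of mass at most θ.
  refine (isScrambling_map (ch.noise s n) Function.injective_id _ ∅).trans ?_
  rw [Set.compl_empty, Set.indicator_univ, MeasureTheory.measure_empty, zero_add]
  simp only [Pi.one_apply, Finset.sum_const, Finset.card_univ, nsmul_eq_mul, mul_one]
  rw [card_block, natCast_pow_eq_ofReal_exp, ← ENNReal.ofReal_mul (Real.exp_nonneg _),
    ← Real.exp_add]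
  refine ENNReal.ofReal_le_ofReal (Real.exp_le_exp.2 (le_of_eq (by ring)))

theorem exists_coe_eq_supEntropyRate [NeZero M] (s : S) :
    ∃ h : ℝ, ch.supEntropyRate s = h := by
  lift ch.supEntropyRate s to ℝ using
    ⟨ne_top_of_le_ne_top (EReal.coe_ne_top _) (ch.supEntropyRate_le_log s),
      ne_bot_of_le_ne_bot EReal.zero_ne_bot (ch.supEntropyRate_nonneg s)⟩ with h
  exact ⟨h, rfl⟩

theorem exists_coe_eq_iSup_supEntropyRate [NeZero M] [Nonempty S] :
    ∃ h : ℝ, (⨆ s, ch.supEntropyRate s) = h := by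
  obtain ⟨s⟩ := ‹Nonempty S›
  lift (⨆ s, ch.supEntropyRate s) to ℝ using
    ⟨ne_top_of_le_ne_top (EReal.coe_ne_top _) (iSup_le ch.supEntropyRate_le_log),
      ne_bot_of_le_ne_bot EReal.zero_ne_bot
        ((ch.supEntropyRate_nonneg s).trans (le_iSup ch.supEntropyRate s))⟩ with h
  exact ⟨h, rfl⟩

/-- Common end of both converses, with a n the information tail or the error probability. -/
theorem supEntropyRate_le_of_eventually_le {s : S} {t ε : ℝ} (hε : 0 < ε) {a : ℕ → ℝ≥0∞}
    (ha : Tendsto a atTop (𝓝 0))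
    (h : ∀ᶠ n in atTop, (ch.noise s n).toOuterMeasure
      {ξ | ch.noise s n ξ ≤ ENNReal.ofReal (Real.exp (-(n * t)))} ≤
        a n + ENNReal.ofReal (Real.exp (-(n * ε)))) : ch.supEntropyRate s ≤ t := by
  refine ch.supEntropyRate_le ?_
  have hlim := ha.add (tendsto_ofReal_exp_neg_mul hε)
  rw [add_zero] at hlim
  refine tendsto_of_tendsto_of_tendsto_of_le_of_le' tendsto_const_nhds hlim
    (Eventually.of_forall fun _ => zero_le) ?_
  filter_upwards [h, eventually_ne_atTop 0] with n h hn
  exact (PMF.toOuterMeasure_mono _ (Set.inter_subset_left.trans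
    (ch.entropyDensity_subset_smallAtoms s hn t))).trans h

/-! ### Restriction to a single state -/

/-- The channel whose only state is `s`. -/
def restrict (s : S) : AdditiveChannel M Unit where
  g _ := ch.g s
  noise _ := ch.noise s
  one_to_one _ := ch.one_to_one s

theorem iSup_supEntropyRate_restrict (s : S) :
    (⨆ u, (ch.restrict s).supEntropyRate u) = ch.supEntropyRate s :=
  iSup_unique _

/-- For one state uniformity is just the definition of the sup-entropy rate, so the compound results
yield the formulas for individual states. -/
theorem uniformNoise_restrict [NeZero M] (s : S) : (ch.restrict s).UniformNoise := by
  intro δ hδ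
  obtain ⟨η, hη⟩ := ch.exists_coe_eq_supEntropyRate s
  rw [iSup_supEntropyRate_restrict, hη, ← EReal.coe_add]
  simp only [EReal.coe_lt_coe_iff, iSup_unique]
  refine ch.tendsto_of_supEntropyRate_lt (s := s) ?_
  rw [hη, EReal.coe_lt_coe_iff]
  linarith

theorem subexponentialStates_restrict (s : S) : (ch.restrict s).SubexponentialStates := by
  refine ⟨fun n => Set.finite_range _, ?_⟩
  simp [Set.range_unique]

end AdditiveChannel

/-! ### Relations between rates and capacities -/

section Relations

variable {S : Type*} {α : ℕ → Type*} {M : ℕ}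

theorem compoundInfRate_le_infRate {β : ℕ → Type*} (P : ∀ n, PMF (α n))
    (κ : S → ∀ n, α n → PMF (β n)) (s : S) : compoundInfRate P κ ≤ infRate P (κ s) :=
  iSup₂_le fun R hR => le_iSup₂_of_le R (tendsto_of_tendsto_of_tendsto_of_le_of_le
    tendsto_const_nhds hR (fun _ => zero_le)
    fun n => le_iSup (fun s => infoLowerTail n (P n) (κ s n) R) s) le_rfl

theorem tsum_bind_mul {A B : Type*} (p : PMF A) (f : A → PMF B) (F : B → ℝ≥0∞) :
    ∑' b, p.bind f b * F b = ∑' a, p a * ∑' b, f a b * F b := by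
  simp_rw [PMF.bind_apply, ← ENNReal.tsum_mul_right, ← ENNReal.tsum_mul_left]
  rw [ENNReal.tsum_comm]
  simp_rw [mul_assoc]

theorem tsum_pure_mul {A : Type*} (a : A) (F : A → ℝ≥0∞) :
    ∑' b, PMF.pure a b * F b = F a := by
  classical
  rw [tsum_eq_single a]
  · simp
  · intro b hb
    simp [PMF.pure_apply, hb]

theorem tsum_map_mul {A B : Type*} (p : PMF A) (f : A → B) (F : B → ℝ≥0∞) :
    ∑' b, p.map f b * F b = ∑' a, p a * F (f a) := by
  rw [PMF.map, tsum_bind_mul]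
  simp_rw [Function.comp_apply, tsum_pure_mul]

theorem Achievable.randomAchievable {κ : CompoundKernel S α M} {R : ℝ} (h : Achievable κ R) :
    RandomAchievable κ R := by
  obtain ⟨K, c, hK, hc⟩ := h
  refine ⟨K, fun n => PMF.pure (c n), hK, ?_⟩
  simpa only [tsum_pure_mul] using hc

theorem opCapacity_le_randomOpCapacity (κ : CompoundKernel S α M) :
    opCapacity κ ≤ randomOpCapacity κ :=
  iSup₂_mono' fun R h => ⟨R, h.randomAchievable, le_rfl⟩

variable {α' : ℕ → Type*}

/-- Codes for `κ` used on a channel `κ'` whose inputs contain those of `κ`. -/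
def BlockCode.mapInput {A A' : Type*} {n K : ℕ} (c : BlockCode S A M n K) (ι : A → A') :
    BlockCode S A' M n K where
  enc := fun w => ι (c.enc w)
  dec := c.dec

theorem BlockCode.error_mapInput {κ : CompoundKernel S α M} {κ' : CompoundKernel S α' M}
    {ι : ∀ n, α n → α' n} (hι : ∀ s n a, κ' s n (ι n a) = κ s n a) {n K : ℕ}
    (c : BlockCode S (α n) M n K) (s : S) : (c.mapInput (ι n)).error κ' s = c.error κ s := by
  simp only [BlockCode.error, BlockCode.mapInput, hι]

theorem opCapacity_mono {κ : CompoundKernel S α M} {κ' : CompoundKernel S α' M}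
    (ι : ∀ n, α n → α' n) (hι : ∀ s n a, κ' s n (ι n a) = κ s n a) :
    opCapacity κ ≤ opCapacity κ' := by
  refine iSup₂_mono' fun R h => ⟨R, ?_, le_rfl⟩
  obtain ⟨K, c, hK, hc⟩ := h
  refine ⟨K, fun n => (c n).mapInput (ι n), hK, ?_⟩
  simpa only [BlockCode.error_mapInput hι] using hc

theorem randomOpCapacity_mono {κ : CompoundKernel S α M} {κ' : CompoundKernel S α' M}
    (ι : ∀ n, α n → α' n) (hι : ∀ s n a, κ' s n (ι n a) = κ s n a) :
    randomOpCapacity κ ≤ randomOpCapacity κ' := by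
  refine iSup₂_mono' fun R h => ⟨R, ?_, le_rfl⟩
  obtain ⟨K, Q, hK, hQ⟩ := h
  refine ⟨K, fun n => (Q n).map (fun c => c.mapInput (ι n)), hK, ?_⟩
  simpa only [tsum_map_mul, BlockCode.error_mapInput hι] using hQ

/-- Relabelling the inputs injectively does not change the information spectrum. -/
theorem infoLowerTail_map {A A' B : Type*} (n : ℕ) (P : PMF A) (κ : A → PMF B) {e : A → A'}
    {κ' : A' → PMF B} (h : ∀ a, κ' (e a) = κ a) (R : ℝ) :
    infoLowerTail n (P.map e) κ' R = infoLowerTail n P κ R := by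
  have hbind : (P.map e).bind κ' = P.bind κ := by
    rw [PMF.bind_map]
    congr 1
    funext a
    exact h a
  rw [infoLowerTail_eq_tsum, infoLowerTail_eq_tsum, hbind, tsum_map_mul]
  simp_rw [h]

end Relations

namespace AdditiveChannel

variable {M : ℕ} [NeZero M] {S : Type*} (ch : AdditiveChannel M S)

/-! ### Converse bounds -/

theorem coe_le_log_sub_supEntropyRate {s : S} {R : ℝ}
    (h : ∀ ε : ℝ, 0 < ε → ch.supEntropyRate s ≤ ((Real.log M - R + ε : ℝ) : EReal)) :
    (R : EReal) ≤ Real.log M - ch.supEntropyRate s := by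
  obtain ⟨η, hη⟩ := ch.exists_coe_eq_supEntropyRate s
  simp only [hη, EReal.coe_le_coe_iff] at h
  rw [hη, ← EReal.coe_sub, EReal.coe_le_coe_iff]
  have := le_of_forall_pos_le_add h
  linarith

theorem infRate_le {α : ℕ → Type*} (P : ∀ n, PMF (α n)) {s : S}
    {κ : ∀ n, α n → PMF (Fin n → ZMod M)} (hκ : ∀ n a, IsScrambling (ch.noise s n) (κ n a)) :
    infRate P κ ≤ Real.log M - ch.supEntropyRate s := by
  refine iSup₂_le fun R hR => ch.coe_le_log_sub_supEntropyRate fun ε hε => ?_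
  -- Here θ = exp(-n(log M - R + ε)), so that θ e^{-nR} M^n = e^{-nε}.
  refine ch.supEntropyRate_le_of_eventually_le hε hR ?_
  filter_upwards [eventually_ne_atTop 0] with n hn
  refine (IsScrambling.smallAtoms_le_infoLowerTail (hκ n) (P n) hn R _).trans
    (add_le_add_right (le_of_eq ?_) _)
  rw [card_block, natCast_pow_eq_ofReal_exp, ← ENNReal.ofReal_mul (Real.exp_nonneg _),
    ← Real.exp_add, ← ENNReal.ofReal_mul (Real.exp_nonneg _), ← Real.exp_add]
  ring_nf

theorem randomOpCapacity_le {α : ℕ → Type*} {κ : CompoundKernel S α M} (s : S)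
    (hκ : ∀ n a, IsScrambling (ch.noise s n) (κ s n a)) :
    randomOpCapacity κ ≤ Real.log M - ch.supEntropyRate s := by
  refine iSup₂_le fun R hR => ch.coe_le_log_sub_supEntropyRate fun ε hε => ?_
  obtain ⟨K, Q, hK, hQ⟩ := hR
  -- Half of ε pays for the rate of the code reaching R only asymptotically.
  refine ch.supEntropyRate_le_of_eventually_le (half_pos hε) hQ ?_
  filter_upwards [eventually_ne_atTop 0, hK (ε / 2) (half_pos hε)] with n hn hKn
  set θ := ENNReal.ofReal (Real.exp (-(n * (Real.log M - R + ε)))) with hθ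
  have hn' : (0 : ℝ) < n := by positivity
  have hK0 : (0 : ℝ) < K n := by
    obtain ⟨c, -⟩ := (Q n).support_nonempty
    exact_mod_cast Fin.pos (c.dec s 0)
  have hcount : θ * ((M : ℝ≥0∞) ^ n / K n) ≤ ENNReal.ofReal (Real.exp (-(n * (ε / 2)))) := by
    rw [lt_div_iff₀ hn'] at hKn
    have hKexp : Real.exp ((R - ε / 2) * n) ≤ K n := by
      rw [← Real.le_log_iff_exp_le hK0]
      exact hKn.le
    rw [natCast_pow_eq_ofReal_exp, ← ENNReal.ofReal_natCast (K n),
      ← ENNReal.ofReal_div_of_pos hK0, hθ, ← ENNReal.ofReal_mul (Real.exp_nonneg _)]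
    refine ENNReal.ofReal_le_ofReal ?_
    rw [← mul_div_assoc, div_le_iff₀ hK0, ← Real.exp_add]
    calc Real.exp (-(n * (Real.log M - R + ε)) + n * Real.log M)
        = Real.exp (-(n * (ε / 2))) * Real.exp ((R - ε / 2) * n) := by
          rw [← Real.exp_add]; ring_nf
      _ ≤ _ := by gcongr
  calc _ ≤ ∑' c, Q n c * (c.error κ s + θ * ((M : ℝ≥0∞) ^ n / K n)) :=
        le_tsum_mul_of_forall_le _ fun c => c.smallAtoms_le_error κ s (hκ n) θ
    _ = ∑' c, Q n c * c.error κ s + θ * ((M : ℝ≥0∞) ^ n / K n) := by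
        simp_rw [mul_add]
        rw [ENNReal.tsum_add, ENNReal.tsum_mul_right, (Q n).tsum_coe, one_mul]
    _ ≤ _ := add_le_add (le_iSup (fun s => ∑' c, Q n c * c.error κ s) s) hcount

/-! ### The uniform input -/

variable (M) in
/-- The independent equiprobable input. -/
noncomputable def uniformInput (n : ℕ) : PMF (Fin n → ZMod M) :=
  PMF.uniformOfFintype _

/-- For fixed y the noise block that explains y runs through all blocks exactly once as x does. -/
theorem uniformInput_bind_kernel (s : S) (n : ℕ) (y : Fin n → ZMod M) :
    (uniformInput M n).bind (ch.kernel s n) y = ((M : ℝ≥0∞) ^ n)⁻¹ := by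
  have hbij : Function.Bijective fun x => y - ch.response s n x :=
    Finite.injective_iff_bijective.mp fun a b h =>
      ch.response_injective s n (sub_right_injective h)
  simp only [PMF.bind_apply, uniformInput, PMF.uniformOfFintype_apply, kernel_apply]
  have hone := (ch.noise s n).tsum_coe
  rw [tsum_fintype] at hone
  rw [ENNReal.tsum_mul_left, tsum_fintype, hbij.sum_comp (ch.noise s n), hone, mul_one,
    card_block]

theorem infoLowerTail_uniformInput_le (s : S) {n : ℕ} (hn : n ≠ 0) {R t : ℝ}
    (h : R < Real.log M - t) : infoLowerTail n (uniformInput M n) (ch.kernel s n) R ≤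
      (ch.noise s n).toOuterMeasure {ξ | t < ch.entropyDensity s n ξ} := by
  have hM : (0 : ℝ) < M := by exact_mod_cast Nat.pos_of_neZero M
  have hn' : (0 : ℝ) < n := by positivity
  rw [infoLowerTail_eq_tsum]
  refine tsum_mul_le_of_forall_le _ fun x => ?_
  simp only [uniformInput_bind_kernel, kernel_apply]
  rw [kernel, PMF.toOuterMeasure_map_apply]
  refine PMF.toOuterMeasure_mono _ ?_
  rintro ξ ⟨hξ, hsupp⟩
  have h0 := (PMF.mem_support_iff _ _).1 hsupp
  have hpos := ENNReal.toReal_pos h0 ((ch.noise s n).apply_ne_top ξ)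
  simp only [Set.mem_preimage, Set.mem_ofPred_eq, add_sub_cancel_left, ENNReal.toReal_inv,
    ENNReal.toReal_pow, ENNReal.toReal_natCast, div_inv_eq_mul] at hξ ⊢
  rw [Real.log_mul hpos.ne' (by positivity), Real.log_pow, inv_mul_eq_div,
    div_le_iff₀ hn'] at hξ
  rw [entropyDensity, inv_mul_eq_div, lt_div_iff₀ hn']
  nlinarith

theorem UniformNoise.tendsto [Nonempty S] {ch : AdditiveChannel M S} (h : ch.UniformNoise)
    {t : ℝ} (ht : (⨆ s, ch.supEntropyRate s) < t) :
    Tendsto (fun n => ⨆ s, (ch.noise s n).toOuterMeasure {ξ | t < ch.entropyDensity s n ξ})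
      atTop (𝓝 0) := by
  obtain ⟨η, hη⟩ := ch.exists_coe_eq_iSup_supEntropyRate
  rw [hη, EReal.coe_lt_coe_iff] at ht
  have := h (t - η) (sub_pos.2 ht)
  rw [hη, ← EReal.coe_add, add_sub_cancel] at this
  simpa only [EReal.coe_lt_coe_iff] using this

theorem le_of_forall_threshold [Nonempty S] {c : EReal}
    (h : ∀ R t : ℝ, (⨆ s, ch.supEntropyRate s) < t → R < Real.log M - t → (R : EReal) ≤ c) :
    Real.log M - (⨆ s, ch.supEntropyRate s) ≤ c := by
  obtain ⟨η, hη⟩ := ch.exists_coe_eq_iSup_supEntropyRate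
  refine EReal.ge_of_forall_gt_iff_ge.1 fun R hR => ?_
  rw [hη, ← EReal.coe_sub, EReal.coe_lt_coe_iff] at hR
  -- The midpoint leaves room on both sides of the threshold.
  refine h R ((η + (Real.log M - R)) / 2) ?_ (by linarith)
  rw [hη, EReal.coe_lt_coe_iff]
  linarith

theorem tendsto_iSup_infoLowerTail_uniformInput [Nonempty S] {ch : AdditiveChannel M S}
    (hu : ch.UniformNoise) {R t : ℝ} (ht : (⨆ s, ch.supEntropyRate s) < t)
    (h : R < Real.log M - t) :
    Tendsto (fun n => ⨆ s, infoLowerTail n (uniformInput M n) (ch.kernel s n) R) atTop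
      (𝓝 0) := by
  refine tendsto_of_tendsto_of_tendsto_of_le_of_le' tendsto_const_nhds (hu.tendsto ht)
    (Eventually.of_forall fun _ => zero_le) ?_
  filter_upwards [eventually_ne_atTop 0] with n hn
  exact iSup_mono fun s => ch.infoLowerTail_uniformInput_le s hn h

theorem le_compoundInfRate_uniformInput [Nonempty S] {ch : AdditiveChannel M S}
    (hu : ch.UniformNoise) : Real.log M - (⨆ s, ch.supEntropyRate s) ≤
      compoundInfRate (uniformInput M) ch.kernel :=
  ch.le_of_forall_threshold fun R _ ht h =>
    le_iSup₂_of_le R (tendsto_iSup_infoLowerTail_uniformInput hu ht h) le_rfl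

variable (M) in
/-- Equiprobable blocks sent without regard to the feedback. -/
noncomputable def uniformScheme (U : Type*) : MessageScheme M U where
  law n := (uniformInput M n).map fun x => (Fintype.equivFin (Fin n → ZMod M) x : ℕ)
  -- The default 0 is used only for labels of probability zero.
  enc n w := constStrategy U (if h : w < Fintype.card (Fin n → ZMod M) then
    (Fintype.equivFin (Fin n → ZMod M)).symm ⟨w, h⟩ else 0)

theorem infoLowerTail_uniformScheme {U : Type*} (s : S) (n : ℕ)
    {κ : Strategy M U n → PMF (Fin n → ZMod M)}
    (hκ : ∀ x, κ (constStrategy U x) = ch.kernel s n x) (R : ℝ) :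
    infoLowerTail n ((uniformScheme M U).law n) (fun w => κ ((uniformScheme M U).enc n w)) R =
      infoLowerTail n (uniformInput M n) (ch.kernel s n) R := by
  refine infoLowerTail_map n _ _ (fun x => ?_) R
  simp only [uniformScheme, hκ, Fin.is_lt, dite_true, Fin.eta, Equiv.symm_apply_apply]

theorem compoundInfRate_uniformScheme {U : Type*} {κ : CompoundKernel S (Strategy M U) M}
    (hκ : ∀ s n x, κ s n (constStrategy U x) = ch.kernel s n x) :
    compoundInfRate (uniformScheme M U).law (fun s n w => κ s n ((uniformScheme M U).enc n w)) =
      compoundInfRate (uniformInput M) ch.kernel := by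
  simp only [compoundInfRate, ch.infoLowerTail_uniformScheme _ _ (hκ _ _)]

theorem feedbackRate_uniformScheme (s : S) :
    ch.feedbackRate (uniformScheme M (ZMod M)) s = ch.rate (uniformInput M) s := by
  simp only [feedbackRate, rate, infRate, ch.infoLowerTail_uniformScheme s _
    (ch.feedbackKernel_constStrategy s)]

theorem rate_uniformInput (s : S) :
    ch.rate (uniformInput M) s = Real.log M - ch.supEntropyRate s := by
  refine le_antisymm (ch.infRate_le _ fun n a => ch.isScrambling_kernel s n a) ?_
  rw [← iSup_supEntropyRate_restrict]
  exact (le_compoundInfRate_uniformInput (ch.uniformNoise_restrict s)).trans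
    (compoundInfRate_le_infRate _ _ ())

end AdditiveChannel

/-! ### Random coding with threshold decoding -/

section RandomCoding

/-- Some i does no worse than average for the sum over T, and that sum dominates each of its terms.
-/
theorem exists_forall_le_card_mul_of_sum_le {ι P : Type*} [Fintype ι] [Nonempty ι]
    (T : Finset P) (f : ι → P → ℝ≥0∞) {b : ℝ≥0∞}
    (h : ∀ p ∈ T, ∑ i, f i p ≤ Fintype.card ι * b) : ∃ i, ∀ p ∈ T, f i p ≤ T.card * b := by
  have hsum : ∑ i, ∑ p ∈ T, f i p ≤ ∑ _i : ι, (T.card : ℝ≥0∞) * b := by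
    rw [Finset.sum_comm]
    refine (Finset.sum_le_sum h).trans_eq ?_
    rw [Finset.sum_const, Finset.sum_const, nsmul_eq_mul, nsmul_eq_mul, Finset.card_univ]
    ring
  obtain ⟨i, hi⟩ : ∃ i, ∑ p ∈ T, f i p ≤ T.card * b := by
    by_contra! hlt
    exact absurd hsum (not_le.2
      (ENNReal.sum_lt_sum_of_nonempty Finset.univ_nonempty fun i _ => hlt i))
  exact ⟨i, fun p hp => (Finset.single_le_sum (fun _ _ => zero_le) hp).trans hi⟩

variable {G : Type*} [Fintype G]

/-- Swapping the entry C w with x is an involution: redrawing one codeword preserves the uniform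
law. This plays the role of independence of the codewords. -/
theorem sum_sum_update {ι : Type*} [Fintype ι] [DecidableEq ι] (w : ι) (F : (ι → G) → ℝ≥0∞) :
    ∑ C : ι → G, ∑ x : G, F (Function.update C w x) = Fintype.card G * ∑ C : ι → G, F C := by
  have hinv : Function.Involutive
      fun p : (ι → G) × G => (Function.update p.1 w p.2, p.1 w) := by
    rintro ⟨C, x⟩
    simp
  rw [← Fintype.sum_prod_type' fun (C : ι → G) (x : G) => F (Function.update C w x),
    hinv.bijective.sum_comp fun p : (ι → G) × G => F p.1, Fintype.sum_prod_type]
  simp [Finset.mul_sum]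

theorem sum_largeAtoms_le (ν : PMF G) {θ : ℝ≥0∞} (h0 : θ ≠ 0) (ht : θ ≠ ∞) :
    ∑ ζ, {ζ | θ ≤ ν ζ}.indicator (1 : G → ℝ≥0∞) ζ ≤ θ⁻¹ := by
  calc ∑ ζ, {ζ | θ ≤ ν ζ}.indicator (1 : G → ℝ≥0∞) ζ ≤ ∑ ζ, θ⁻¹ * ν ζ := by
        refine Finset.sum_le_sum fun ζ _ => Set.indicator_le' (g := fun ζ => θ⁻¹ * ν ζ)
          (fun ζ hζ => ?_) (fun _ _ => zero_le) ζ
        rw [Pi.one_apply, ← ENNReal.inv_mul_cancel h0 ht]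
        exact mul_le_mul_right hζ _
    _ = θ⁻¹ := by rw [← Finset.mul_sum, ← tsum_fintype (L := .unconditional G), ν.tsum_coe, mul_one]

variable [AddCommGroup G]

/-- The average over the messages of the expected number of wrong messages that explain the
output by a noise block of probability at least `θ`. -/
noncomputable def confusion (r : G → G) (ν : PMF G) (θ : ℝ≥0∞) {K : ℕ} (C : Fin K → G) : ℝ≥0∞ :=
  (∑ w : Fin K, ∑ w' ∈ Finset.univ.erase w,
    ν.toOuterMeasure {ξ | θ ≤ ν (r (C w) + ξ - r (C w'))}) / (K : ℝ≥0∞)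

/-- Redraw the wrong codeword with C w and ξ fixed: the noise needed to explain the output is then
equidistributed on G, and at most 1/θ values have mass at least θ. -/
theorem sum_confusion_pair_le {r : G → G} (hr : Function.Injective r) (ν : PMF G) {θ : ℝ≥0∞}
    (h0 : θ ≠ 0) (ht : θ ≠ ∞) {K : ℕ} {w w' : Fin K} (hw : w' ≠ w) :
    ∑ C : Fin K → G, ν.toOuterMeasure {ξ | θ ≤ ν (r (C w) + ξ - r (C w'))} ≤
      Fintype.card (Fin K → G) * (θ⁻¹ / Fintype.card G) := by
  have hG : (Fintype.card G : ℝ≥0∞) ≠ 0 := by exact_mod_cast Fintype.card_ne_zero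
  have hGt : (Fintype.card G : ℝ≥0∞) ≠ ∞ := ENNReal.natCast_ne_top _
  have hx : ∀ b : G, ∑ x, ν.toOuterMeasure {ξ | θ ≤ ν (b + ξ - r x)} ≤ θ⁻¹ := by
    intro b
    simp_rw [PMF.toOuterMeasure_apply_fintype]
    rw [Finset.sum_comm]
    calc ∑ ξ, ∑ x, {ξ | θ ≤ ν (b + ξ - r x)}.indicator ν ξ
        ≤ ∑ ξ, ν ξ * θ⁻¹ := by
          refine Finset.sum_le_sum fun ξ _ => ?_
          have hbij : Function.Bijective fun x => b + ξ - r x :=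
            Finite.injective_iff_bijective.mp fun _ _ h => hr (sub_right_injective h)
          have : ∀ x, {ξ | θ ≤ ν (b + ξ - r x)}.indicator ν ξ =
              ν ξ * {ζ | θ ≤ ν ζ}.indicator (1 : G → ℝ≥0∞) (b + ξ - r x) := by
            intro x
            simp only [Set.indicator_apply, Set.mem_ofPred_eq, Pi.one_apply, mul_ite, mul_one,
              mul_zero]
          simp_rw [this]
          rw [← Finset.mul_sum,
            hbij.sum_comp fun ζ => {ζ | θ ≤ ν ζ}.indicator (1 : G → ℝ≥0∞) ζ]
          exact mul_le_mul_right (sum_largeAtoms_le ν h0 ht) _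
      _ = θ⁻¹ := by
          rw [← Finset.sum_mul, ← tsum_fintype (L := .unconditional G), ν.tsum_coe, one_mul]
  have hsum := sum_sum_update w'
    fun C : Fin K → G => ν.toOuterMeasure {ξ | θ ≤ ν (r (C w) + ξ - r (C w'))}
  simp only [Function.update_self, Function.update_of_ne hw.symm] at hsum
  rw [← mul_div_assoc, ENNReal.le_div_iff_mul_le (Or.inl hG) (Or.inl hGt), mul_comm, ← hsum]
  calc _ ≤ ∑ _C : Fin K → G, θ⁻¹ := Finset.sum_le_sum fun C _ => hx (r (C w))
    _ = _ := by rw [Finset.sum_const, Finset.card_univ, nsmul_eq_mul]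

theorem sum_confusion_le {r : G → G} (hr : Function.Injective r) (ν : PMF G) {θ : ℝ≥0∞}
    (h0 : θ ≠ 0) (ht : θ ≠ ∞) (k : ℕ) :
    ∑ C : Fin (k + 1) → G, confusion r ν θ C ≤
      Fintype.card (Fin (k + 1) → G) * (k * (θ⁻¹ / Fintype.card G)) := by
  simp only [confusion, div_eq_mul_inv]
  rw [← Finset.sum_mul, ← div_eq_mul_inv]
  refine ENNReal.div_le_of_le_mul ?_
  rw [Finset.sum_comm]
  calc _ ≤ ∑ _w : Fin (k + 1), ∑ _w' ∈ Finset.univ.erase _w,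
        (Fintype.card (Fin (k + 1) → G) * (θ⁻¹ / Fintype.card G) : ℝ≥0∞) := by
        refine Finset.sum_le_sum fun w _ => ?_
        rw [Finset.sum_comm]
        exact Finset.sum_le_sum fun w' hw' =>
          sum_confusion_pair_le hr ν h0 ht (Finset.ne_of_mem_erase hw')
    _ = _ := by
      simp only [Finset.sum_const, Finset.card_erase_of_mem (Finset.mem_univ _),
        Finset.card_univ, Fintype.card_fin, nsmul_eq_mul, add_tsub_cancel_right, div_eq_mul_inv]
      push_cast
      ring

end RandomCoding

/-! ### Threshold codes for the additive channel -/

namespace AdditiveChannel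

variable {M : ℕ} {S : Type*} (ch : AdditiveChannel M S)

open Classical in
/-- The code with codebook `C` whose decoder looks for a message that explains the output by a
noise block of probability at least `θ`. -/
noncomputable def thresholdCode {n k : ℕ} (θ : ℝ≥0∞) (C : Fin (k + 1) → Fin n → ZMod M) :
    BlockCode S (Fin n → ZMod M) M n (k + 1) where
  enc := C
  dec s y := if h : ∃ w, θ ≤ ch.noise s n (y - ch.response s n (C w)) then h.choose else 0

/-- If the true noise has mass at least θ, the sent message passes the test, so an error means that
the chosen message is a rival which passes too. How ties are broken is irrelevant. -/
theorem thresholdCode_error_le {n k : ℕ} (θ : ℝ≥0∞) (C : Fin (k + 1) → Fin n → ZMod M) (s : S) :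
    (ch.thresholdCode θ C).error ch.kernel s ≤
      (ch.noise s n).toOuterMeasure {ξ | ch.noise s n ξ < θ} +
        confusion (ch.response s n) (ch.noise s n) θ C := by
  classical
  set ν := ch.noise s n with hν
  set r := ch.response s n with hr
  have hK : ((k + 1 : ℕ) : ℝ≥0∞) ≠ 0 := by exact_mod_cast Nat.succ_ne_zero k
  have hKt : ((k + 1 : ℕ) : ℝ≥0∞) ≠ ∞ := ENNReal.natCast_ne_top _
  have hw : ∀ w, (ch.kernel s n (C w)).toOuterMeasure
      {y | (ch.thresholdCode θ C).dec s y ≠ w} ≤ ν.toOuterMeasure {ξ | ν ξ < θ} +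
        ∑ w' ∈ Finset.univ.erase w, ν.toOuterMeasure {ξ | θ ≤ ν (r (C w) + ξ - r (C w'))} := by
    intro w
    rw [kernel, PMF.toOuterMeasure_map_apply]
    calc _ ≤ ν.toOuterMeasure ({ξ | ν ξ < θ} ∪ ⋃ w' ∈ Finset.univ.erase w,
          {ξ | θ ≤ ν (r (C w) + ξ - r (C w'))}) := by
          refine MeasureTheory.measure_mono fun ξ hξ => ?_
          by_cases hlow : ν ξ < θ
          · exact Or.inl hlow
          right
          have hex : ∃ w', θ ≤ ν (r (C w) + ξ - r (C w')) :=
            ⟨w, by simpa using hlow⟩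
          have hne : hex.choose ≠ w := by
            simpa only [thresholdCode, Set.mem_preimage, Set.mem_ofPred_eq, ← hν, ← hr,
              dif_pos hex] using hξ
          exact Set.mem_biUnion (Finset.mem_coe.2 (Finset.mem_erase.2 ⟨hne, Finset.mem_univ _⟩))
            hex.choose_spec
      _ ≤ _ := (MeasureTheory.measure_union_le _ _).trans
          (add_le_add_right (MeasureTheory.measure_biUnion_finset_le _ _) _)
  rw [BlockCode.error, confusion]
  refine ENNReal.div_le_of_le_mul ?_
  rw [add_mul, ENNReal.div_mul_cancel hK hKt]
  refine (Finset.sum_le_sum fun w _ => hw w).trans (le_of_eq ?_)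
  rw [Finset.sum_add_distrib, Finset.sum_const, Finset.card_univ, Fintype.card_fin,
    nsmul_eq_mul, mul_comm]

theorem thresholdCode_error_le_entropy {n k : ℕ} (hn : n ≠ 0) (t : ℝ)
    (C : Fin (k + 1) → Fin n → ZMod M) (s : S) :
    (ch.thresholdCode (ENNReal.ofReal (Real.exp (-(n * t)))) C).error ch.kernel s ≤
      (ch.noise s n).toOuterMeasure {ξ | t < ch.entropyDensity s n ξ} +
        confusion (ch.response s n) (ch.noise s n) (ENNReal.ofReal (Real.exp (-(n * t)))) C := by
  refine (ch.thresholdCode_error_le _ C s).trans (add_le_add_left ?_ _)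
  exact PMF.toOuterMeasure_mono _ fun ξ hξ =>
    ch.lt_entropyDensity_of_lt s hn ((PMF.mem_support_iff _ _).1 hξ.2) hξ.1

/-- One less than the number of messages of the random codes of rate `R`. -/
noncomputable def spareMessages (R : ℝ) (n : ℕ) : ℕ := ⌊Real.exp (n * R)⌋₊

theorem lt_log_spareMessages_add_one_div (R : ℝ) {δ : ℝ} (hδ : 0 < δ) {n : ℕ} (hn : n ≠ 0) :
    R - δ < Real.log ((spareMessages R n + 1 : ℕ) : ℝ) / n := by
  have hn' : (0 : ℝ) < n := by positivity
  have h : R * n ≤ Real.log ((spareMessages R n + 1 : ℕ) : ℝ) := by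
    rw [Real.le_log_iff_exp_le (by positivity), mul_comm]
    push_cast
    exact (Nat.lt_floor_add_one _).le
  rw [lt_div_iff₀ hn']
  nlinarith

theorem spareMessages_le (R : ℝ) (n : ℕ) : (spareMessages R n : ℝ) ≤ Real.exp (n * R) :=
  Nat.floor_le (Real.exp_nonneg _)

theorem SubexponentialStates.tendsto [Nonempty S] {ch : AdditiveChannel M S}
    (hsub : ch.SubexponentialStates) {ε : ℝ} (hε : 0 < ε) :
    Tendsto (fun n : ℕ => ((Set.range fun s => (ch.response s n, ch.noise s n)).ncard : ℝ≥0∞) *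
      ENNReal.ofReal (Real.exp (-(n * ε)))) atTop (𝓝 0) := by
  refine tendsto_of_tendsto_of_tendsto_of_le_of_le' tendsto_const_nhds
    (tendsto_ofReal_exp_neg_mul (half_pos hε)) (Eventually.of_forall fun _ => zero_le) ?_
  -- Eventually N_n < e^{nε/2}, which uses up half of the exponent.
  filter_upwards [eventually_ne_atTop 0, hsub.2.eventually (gt_mem_nhds (half_pos hε))]
    with n hn hlog
  have hn' : (0 : ℝ) < n := by positivity
  set N := (Set.range fun s => (ch.response s n, ch.noise s n)).ncard
  have hN : (0 : ℝ) < N := by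
    exact_mod_cast (Set.ncard_pos (hsub.1 n)).2 (Set.range_nonempty _)
  rw [div_lt_iff₀ hn', Real.log_lt_iff_lt_exp hN] at hlog
  rw [← ENNReal.ofReal_natCast, ← ENNReal.ofReal_mul hN.le]
  refine ENNReal.ofReal_le_ofReal ?_
  calc (N : ℝ) * Real.exp (-(n * ε)) ≤ Real.exp (ε / 2 * n) * Real.exp (-(n * ε)) := by gcongr
    _ = _ := by rw [← Real.exp_add]; ring_nf

variable [NeZero M]

/-- At most e^{nR} rivals, each confused with average probability at most e^{nt}/M^n. -/
theorem sum_confusion_le_exp {R t : ℝ} (s : S) {n k : ℕ} (hk : (k : ℝ) ≤ Real.exp (n * R)) :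
    ∑ C : Fin (k + 1) → Fin n → ZMod M, confusion (ch.response s n)
      (ch.noise s n) (ENNReal.ofReal (Real.exp (-(n * t)))) C ≤
    Fintype.card (Fin (k + 1) → Fin n → ZMod M) *
      ENNReal.ofReal (Real.exp (-(n * (Real.log M - t - R)))) := by
  refine (sum_confusion_le (ch.response_injective s n) _ ?_ ENNReal.ofReal_ne_top _).trans
    (mul_le_mul_right ?_ _)
  · exact (ENNReal.ofReal_pos.2 (Real.exp_pos _)).ne'
  rw [card_block, natCast_pow_eq_ofReal_exp, ← ENNReal.ofReal_inv_of_pos (Real.exp_pos _),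
    ← ENNReal.ofReal_div_of_pos (Real.exp_pos _), ← ENNReal.ofReal_natCast,
    ← ENNReal.ofReal_mul (Nat.cast_nonneg _), ← Real.exp_neg, ← Real.exp_sub]
  refine ENNReal.ofReal_le_ofReal ?_
  calc _ ≤ Real.exp (n * R) * Real.exp (- -(n * t) - n * Real.log M) := by gcongr
    _ = _ := by rw [← Real.exp_add]; ring_nf

/-- The law of the threshold code with independent equiprobable codewords. -/
noncomputable def randomCode (n k : ℕ) (θ : ℝ≥0∞) :
    PMF (BlockCode S (Fin n → ZMod M) M n (k + 1)) :=
  (PMF.uniformOfFintype (Fin (k + 1) → Fin n → ZMod M)).map (ch.thresholdCode θ)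

theorem tsum_randomCode_error_le {R t : ℝ} (s : S) {n k : ℕ} (hn : n ≠ 0)
    (hk : (k : ℝ) ≤ Real.exp (n * R)) :
    ∑' c, ch.randomCode n k (ENNReal.ofReal (Real.exp (-(n * t)))) c * c.error ch.kernel s ≤
      (ch.noise s n).toOuterMeasure {ξ | t < ch.entropyDensity s n ξ} +
        ENNReal.ofReal (Real.exp (-(n * (Real.log M - t - R)))) := by
  rw [randomCode, tsum_map_mul]
  refine (ENNReal.tsum_le_tsum fun C => mul_le_mul_right
    (ch.thresholdCode_error_le_entropy hn t C s) _).trans ?_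
  simp_rw [mul_add]
  rw [ENNReal.tsum_add, ENNReal.tsum_mul_right, PMF.tsum_coe, one_mul]
  refine add_le_add_right ?_ _
  simp only [PMF.uniformOfFintype_apply]
  rw [ENNReal.tsum_mul_left, tsum_fintype, mul_comm, ← div_eq_mul_inv]
  refine ENNReal.div_le_of_le_mul ?_
  exact (ch.sum_confusion_le_exp s hk).trans_eq (mul_comm _ _)

variable {ch}

theorem UniformNoise.randomAchievable [Nonempty S] (hu : ch.UniformNoise) {R t : ℝ}
    (ht : (⨆ s, ch.supEntropyRate s) < t) (h : R < Real.log M - t) :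
    RandomAchievable ch.kernel R := by
  refine ⟨fun n => spareMessages R n + 1, fun n => ch.randomCode n (spareMessages R n)
    (ENNReal.ofReal (Real.exp (-(n * t)))), fun δ hδ => ?_, ?_⟩
  · filter_upwards [eventually_ne_atTop 0] with n hn
    exact lt_log_spareMessages_add_one_div R hδ hn
  have hlim := (hu.tendsto ht).add (tendsto_ofReal_exp_neg_mul (ε := Real.log M - t - R)
    (by linarith))
  rw [add_zero] at hlim
  refine tendsto_of_tendsto_of_tendsto_of_le_of_le' tendsto_const_nhds hlim
    (Eventually.of_forall fun _ => zero_le) ?_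
  filter_upwards [eventually_ne_atTop 0] with n hn
  refine iSup_le fun s => (ch.tsum_randomCode_error_le s hn (spareMessages_le R n)).trans ?_
  exact add_le_add_left (le_iSup (fun s => (ch.noise s n).toOuterMeasure
    {ξ | t < ch.entropyDensity s n ξ}) s) _

/-- A single codebook serves all the finitely many channels of a given blocklength. -/
theorem exists_codebook_confusion_le {R : ℝ} (t : ℝ) {n k : ℕ} (hk : (k : ℝ) ≤ Real.exp (n * R))
    (hfin : (Set.range fun s => (ch.response s n, ch.noise s n)).Finite) :
    ∃ C : Fin (k + 1) → Fin n → ZMod M, ∀ s,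
      confusion (ch.response s n) (ch.noise s n) (ENNReal.ofReal (Real.exp (-(n * t)))) C ≤
        (Set.range fun s => (ch.response s n, ch.noise s n)).ncard *
          ENNReal.ofReal (Real.exp (-(n * (Real.log M - t - R)))) := by
  obtain ⟨C, hC⟩ := exists_forall_le_card_mul_of_sum_le hfin.toFinset
    (fun (C : Fin (k + 1) → Fin n → ZMod M) p =>
      confusion p.1 p.2 (ENNReal.ofReal (Real.exp (-(n * t)))) C)
    (b := ENNReal.ofReal (Real.exp (-(n * (Real.log M - t - R))))) (by
      intro p hp
      obtain ⟨s, rfl⟩ := hfin.mem_toFinset.1 hp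
      exact ch.sum_confusion_le_exp s hk)
  refine ⟨C, fun s => ?_⟩
  have h := hC (ch.response s n, ch.noise s n) (hfin.mem_toFinset.2 ⟨s, rfl⟩)
  rwa [← Set.ncard_eq_toFinset_card _ hfin] at h

theorem UniformNoise.achievable [Nonempty S] (hu : ch.UniformNoise)
    (hsub : ch.SubexponentialStates) {R t : ℝ}
    (ht : (⨆ s, ch.supEntropyRate s) < t) (h : R < Real.log M - t) :
    Achievable ch.kernel R := by
  choose C hC using fun n =>
    exists_codebook_confusion_le t (spareMessages_le R n) (hsub.1 n)
  refine ⟨fun n => spareMessages R n + 1, fun n =>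
    ch.thresholdCode (ENNReal.ofReal (Real.exp (-(n * t)))) (C n), fun δ hδ => ?_, ?_⟩
  · filter_upwards [eventually_ne_atTop 0] with n hn
    exact lt_log_spareMessages_add_one_div R hδ hn
  have hlim := (hu.tendsto ht).add (hsub.tendsto (ε := Real.log M - t - R) (by linarith))
  rw [add_zero] at hlim
  refine tendsto_of_tendsto_of_tendsto_of_le_of_le' tendsto_const_nhds hlim
    (Eventually.of_forall fun _ => zero_le) ?_
  filter_upwards [eventually_ne_atTop 0] with n hn
  refine iSup_le fun s => (ch.thresholdCode_error_le_entropy hn t (C n) s).trans ?_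
  exact add_le_add (le_iSup (fun s => (ch.noise s n).toOuterMeasure
    {ξ | t < ch.entropyDensity s n ξ}) s) (hC n s)

theorem UniformNoise.le_randomOpCapacity [Nonempty S] (hu : ch.UniformNoise) :
    Real.log M - (⨆ s, ch.supEntropyRate s) ≤ randomOpCapacity ch.kernel :=
  ch.le_of_forall_threshold fun R _ ht h => le_iSup₂_of_le R (hu.randomAchievable ht h) le_rfl

theorem UniformNoise.le_opCapacity [Nonempty S] (hu : ch.UniformNoise)
    (hsub : ch.SubexponentialStates) :
    Real.log M - (⨆ s, ch.supEntropyRate s) ≤ opCapacity ch.kernel :=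
  ch.le_of_forall_threshold fun R _ ht h => le_iSup₂_of_le R (hu.achievable hsub ht h) le_rfl

/-! ### The capacity formulas -/

variable (ch)

theorem iInf_log_sub_supEntropyRate [Nonempty S] :
    (⨅ s, ((Real.log M : EReal) - ch.supEntropyRate s)) =
      Real.log M - ⨆ s, ch.supEntropyRate s := by
  refine le_antisymm ?_ (le_iInf fun s => EReal.sub_le_sub le_rfl (le_iSup ch.supEntropyRate s))
  obtain ⟨H, hH⟩ := ch.exists_coe_eq_iSup_supEntropyRate
  refine EReal.ge_of_forall_gt_iff_ge.1 fun R hR => ?_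
  have hle : (⨆ s, ch.supEntropyRate s) ≤ ((Real.log M - R : ℝ) : EReal) := by
    refine iSup_le fun s => ?_
    obtain ⟨η, hη⟩ := ch.exists_coe_eq_supEntropyRate s
    have := hR.le.trans (iInf_le _ s)
    rw [hη, ← EReal.coe_sub, EReal.coe_le_coe_iff] at this
    rw [hη, EReal.coe_le_coe_iff]
    linarith
  rw [hH, EReal.coe_le_coe_iff] at hle
  rw [hH, ← EReal.coe_sub, EReal.coe_le_coe_iff]
  linarith

theorem rate_le (X : ∀ n, PMF (Fin n → ZMod M)) (s : S) :
    ch.rate X s ≤ Real.log M - ch.supEntropyRate s :=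
  ch.infRate_le X fun n x => ch.isScrambling_kernel s n x

theorem feedbackRate_le (WF : MessageScheme M (ZMod M)) (s : S) :
    ch.feedbackRate WF s ≤ Real.log M - ch.supEntropyRate s :=
  ch.infRate_le _ fun n _ => ch.isScrambling_feedbackKernel s n _

theorem iSup_rate (s : S) : (⨆ X, ch.rate X s) = Real.log M - ch.supEntropyRate s :=
  le_antisymm (iSup_le fun X => ch.rate_le X s)
    (le_iSup_of_le (uniformInput M) (ch.rate_uniformInput s).ge)

theorem iSup_feedbackRate (s : S) :
    (⨆ WF, ch.feedbackRate WF s) = Real.log M - ch.supEntropyRate s :=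
  le_antisymm (iSup_le fun WF => ch.feedbackRate_le WF s)
    (le_iSup_of_le (uniformScheme M (ZMod M))
      ((ch.feedbackRate_uniformScheme s).trans (ch.rate_uniformInput s)).ge)

theorem C_w_eq : ch.C_w = ⨅ s, ((Real.log M : EReal) - ch.supEntropyRate s) :=
  iInf_congr ch.iSup_feedbackRate

/-- The equiprobable input attains the upper bound in every state simultaneously, so supremum and
infimum commute. -/
theorem iSup_iInf_rate : (⨆ X, ⨅ s, ch.rate X s) = ch.C_w := by
  rw [C_w_eq]
  refine le_antisymm (iSup_le fun X => iInf_mono fun s => ch.rate_le X s) ?_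
  exact le_iSup_of_le (uniformInput M) (iInf_mono fun s => (ch.rate_uniformInput s).ge)

theorem iSup_iInf_feedbackRate : (⨆ WF, ⨅ s, ch.feedbackRate WF s) = ch.C_w := by
  rw [C_w_eq]
  refine le_antisymm (iSup_le fun WF => iInf_mono fun s => ch.feedbackRate_le WF s) ?_
  exact le_iSup_of_le (uniformScheme M (ZMod M)) (iInf_mono fun s =>
    ((ch.feedbackRate_uniformScheme s).trans (ch.rate_uniformInput s)).ge)

theorem opCapacity_atState_kernel (s : S) :
    opCapacity (atState ch.kernel s) = Real.log M - ch.supEntropyRate s := by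
  refine le_antisymm ((opCapacity_le_randomOpCapacity _).trans
    ((ch.restrict s).randomOpCapacity_le () fun n x => ch.isScrambling_kernel s n x)) ?_
  rw [← iSup_supEntropyRate_restrict]
  exact (ch.uniformNoise_restrict s).le_opCapacity (ch.subexponentialStates_restrict s)

theorem opCapacity_atState_feedbackKernel (s : S) :
    opCapacity (atState ch.feedbackKernel s) = Real.log M - ch.supEntropyRate s := by
  refine le_antisymm ((opCapacity_le_randomOpCapacity _).trans
    ((ch.restrict s).randomOpCapacity_le () fun n f => ch.isScrambling_feedbackKernel s n f)) ?_
  rw [← opCapacity_atState_kernel]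
  exact opCapacity_mono (fun _ => constStrategy (ZMod M))
    fun _ _ x => ch.feedbackKernel_constStrategy s x

variable {ch}

/-- Uniformity of the noise enters here: the compound rate asks for tails that vanish uniformly in
the state, not only in each state. -/
theorem UniformNoise.C_w_le_compoundInfRate [Nonempty S] (hu : ch.UniformNoise) :
    ch.C_w ≤ compoundInfRate (uniformInput M) ch.kernel := by
  rw [C_w_eq, iInf_log_sub_supEntropyRate]
  exact le_compoundInfRate_uniformInput hu

theorem UniformNoise.C_NFB_eq [Nonempty S] (hu : ch.UniformNoise) : ch.C_NFB = ch.C_w := by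
  refine le_antisymm ?_ (le_iSup_of_le (uniformInput M) hu.C_w_le_compoundInfRate)
  rw [C_w_eq]
  exact iSup_le fun X => le_iInf fun s =>
    (compoundInfRate_le_infRate X ch.kernel s).trans (ch.rate_le X s)

/-- The compound capacity of any feedback channel that scrambles the noise and behaves like the
channel without feedback if the feedback is ignored. -/
theorem UniformNoise.iSup_compoundInfRate_eq [Nonempty S] (hu : ch.UniformNoise) {U : Type*}
    {κ : CompoundKernel S (Strategy M U) M}
    (hκ : ∀ s n x, κ s n (constStrategy U x) = ch.kernel s n x)
    (hscr : ∀ s n f, IsScrambling (ch.noise s n) (κ s n f)) :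
    (⨆ WF : MessageScheme M U, compoundInfRate WF.law fun s n w => κ s n (WF.enc n w)) =
      ch.C_w := by
  refine le_antisymm ?_ (le_iSup_of_le (uniformScheme M U) ?_)
  · rw [C_w_eq]
    exact iSup_le fun WF => le_iInf fun s => (compoundInfRate_le_infRate _ _ s).trans
      (ch.infRate_le _ fun n _ => hscr s n _)
  · rw [ch.compoundInfRate_uniformScheme hκ]
    exact hu.C_w_le_compoundInfRate

theorem UniformNoise.randomOpCapacity_eq [Nonempty S] (hu : ch.UniformNoise) {α : ℕ → Type*}
    {κ : CompoundKernel S α M} (ι : ∀ n, (Fin n → ZMod M) → α n)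
    (hκ : ∀ s n x, κ s n (ι n x) = ch.kernel s n x)
    (hscr : ∀ s n a, IsScrambling (ch.noise s n) (κ s n a)) :
    randomOpCapacity κ = ch.C_w := by
  rw [C_w_eq]
  refine le_antisymm (le_iInf fun s => ch.randomOpCapacity_le s (hscr s)) ?_
  rw [iInf_log_sub_supEntropyRate]
  exact hu.le_randomOpCapacity.trans (randomOpCapacity_mono ι hκ)

theorem UniformNoise.opCapacity_eq [Nonempty S] (hu : ch.UniformNoise)
    (hsub : ch.SubexponentialStates) {α : ℕ → Type*}
    {κ : CompoundKernel S α M} (ι : ∀ n, (Fin n → ZMod M) → α n)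
    (hκ : ∀ s n x, κ s n (ι n x) = ch.kernel s n x)
    (hscr : ∀ s n a, IsScrambling (ch.noise s n) (κ s n a)) :
    opCapacity κ = ch.C_w := by
  rw [C_w_eq]
  refine le_antisymm (le_iInf fun s => (opCapacity_le_randomOpCapacity κ).trans
    (ch.randomOpCapacity_le s (hscr s))) ?_
  rw [iInf_log_sub_supEntropyRate]
  exact (hu.le_opCapacity hsub).trans (opCapacity_mono ι hκ)

end AdditiveChannel

end CompoundChannel

theorem theorem3 {M : ℕ} [NeZero M] {S : Type*} [Nonempty S]
    (ch : CompoundChannel.AdditiveChannel M S) (huniform : ch.UniformNoise)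
    {U : Type*} (Φ : S → (n : ℕ) → PMF (CompoundChannel.FeedbackMap M U n)) :
    -- the capacities agree
    (ch.C_NFB = ch.C_FB ∧ ch.C_FB = ch.C_w ∧ ch.C_noisyFB Φ = ch.C_w) ∧
    -- minimax equalities, without and with feedback
    ((⨅ s, ⨆ X, ch.rate X s) = ch.C_w ∧ (⨆ X, ⨅ s, ch.rate X s) = ch.C_w) ∧
    (⨅ s, ⨆ WF, ch.feedbackRate WF s) = (⨆ WF, ⨅ s, ch.feedbackRate WF s) ∧
    -- saddle points, without and with feedback, at every state that attains the infimum
    (∃ Xopt, ∀ sopt, (⨆ X, ch.rate X sopt) = (⨅ s, ⨆ X, ch.rate X s) →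
      (∀ X, ch.rate X sopt ≤ ch.rate Xopt sopt) ∧
      (∀ s, ch.rate Xopt sopt ≤ ch.rate Xopt s)) ∧
    (∃ WFopt, ∀ sopt,
      (⨆ WF, ch.feedbackRate WF sopt) = (⨅ s, ⨆ WF, ch.feedbackRate WF s) →
      (∀ WF, ch.feedbackRate WF sopt ≤ ch.feedbackRate WFopt sopt) ∧
      (∀ s, ch.feedbackRate WFopt sopt ≤ ch.feedbackRate WFopt s)) ∧
    -- operational meaning: codes tailored to the state
    ((⨅ s, CompoundChannel.opCapacity (CompoundChannel.atState ch.kernel s)) = ch.C_w ∧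
      (⨅ s, CompoundChannel.opCapacity (CompoundChannel.atState ch.feedbackKernel s)) = ch.C_w) ∧
    -- operational meaning: random codes that do not depend on the state
    (CompoundChannel.randomOpCapacity ch.kernel = ch.C_w ∧
      CompoundChannel.randomOpCapacity ch.feedbackKernel = ch.C_w ∧
      CompoundChannel.randomOpCapacity (ch.noisyFeedbackKernel Φ) = ch.C_w) ∧
    -- operational meaning: deterministic codes that do not depend on the state
    (ch.SubexponentialStates →
      CompoundChannel.opCapacity ch.kernel = ch.C_w ∧
      CompoundChannel.opCapacity ch.feedbackKernel = ch.C_w ∧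
      CompoundChannel.opCapacity (ch.noisyFeedbackKernel Φ) = ch.C_w) := by
  have hfb := ch.feedbackKernel_constStrategy
  have hnfb := ch.noisyFeedbackKernel_constStrategy Φ
  have hker := ch.isScrambling_kernel
  have hfbs := ch.isScrambling_feedbackKernel
  have hnfbs := ch.isScrambling_noisyFeedbackKernel Φ
  have hFB : ch.C_FB = ch.C_w := huniform.iSup_compoundInfRate_eq (fun s _ => hfb s) hfbs
  have hrate : (⨅ s, ⨆ X, ch.rate X s) = ch.C_w :=
    (iInf_congr ch.iSup_rate).trans ch.C_w_eq.symm
  refine ⟨⟨huniform.C_NFB_eq.trans hFB.symm, hFB,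
      huniform.iSup_compoundInfRate_eq
        (fun s _ => hnfb s) hnfbs⟩,
    ⟨hrate, ch.iSup_iInf_rate⟩, ch.iSup_iInf_feedbackRate.symm,
    ⟨CompoundChannel.AdditiveChannel.uniformInput M, fun sopt hopt => ⟨fun X => ?_, fun s => ?_⟩⟩,
    ⟨CompoundChannel.AdditiveChannel.uniformScheme M (ZMod M), fun sopt hopt =>
      ⟨fun WF => ?_, fun s => ?_⟩⟩,
    ⟨(iInf_congr ch.opCapacity_atState_kernel).trans ch.C_w_eq.symm,
      (iInf_congr ch.opCapacity_atState_feedbackKernel).trans ch.C_w_eq.symm⟩,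
    ⟨huniform.randomOpCapacity_eq (fun _ x => x) (fun _ _ _ => rfl) hker,
      huniform.randomOpCapacity_eq (fun _ => CompoundChannel.constStrategy (ZMod M))
        (fun s _ => hfb s) hfbs,
      huniform.randomOpCapacity_eq (fun _ => CompoundChannel.constStrategy U)
        (fun s _ => hnfb s) hnfbs⟩,
    fun hsub => ⟨huniform.opCapacity_eq hsub (fun _ x => x) (fun _ _ _ => rfl) hker,
      huniform.opCapacity_eq hsub (fun _ => CompoundChannel.constStrategy (ZMod M))
        (fun s _ => hfb s) hfbs,
      huniform.opCapacity_eq hsub (fun _ => CompoundChannel.constStrategy U)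
        (fun s _ => hnfb s) hnfbs⟩⟩
  · rw [ch.rate_uniformInput]
    exact ch.rate_le X sopt
  -- The rate of the equiprobable input in a state is the supremum over inputs there, and `sopt`
  -- minimizes that supremum.
  · rw [ch.rate_uniformInput, ← ch.iSup_rate, hopt, ch.rate_uniformInput, ← ch.iSup_rate]
    exact iInf_le _ s
  · rw [ch.feedbackRate_uniformScheme, ch.rate_uniformInput]
    exact ch.feedbackRate_le WF sopt
  · rw [ch.feedbackRate_uniformScheme, ch.feedbackRate_uniformScheme, ch.rate_uniformInput,
      ← ch.iSup_feedbackRate, hopt, ch.rate_uniformInput, ← ch.iSup_feedbackRate]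
    exact iInf_le _ s
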